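/- **Claim (path hopset impossibility).** For all integers $n,\ell$ with $1\le \ell<n$ and every $\varepsilon\in[0,1]$ there are a directed graph $G=G_{n,\varepsilon,\ell}$ on $n$ vertices with positive real edge weights and a directed path $P=P_{n,\varepsilon,\ell}$ in $G$ with $\ell$ hops (that is, on $|P|=\ell+1$ distinct vertices) such that the following holds. Let $\varepsilon(n)\in[0,1]$ be arbitrary and let $\ell(n)$ be polynomial in $n$, meaning that $n^{a}\le \ell(n)\le n^{b}$ for some constants $a,b>0$ and all large $n$, with $\ell(n)<n$ for all large $n$. Write $G_n=G_{n,\varepsilon(n),\ell(n)}$ and $P_n=P_{n,\varepsilon(n),\ell(n)}$. Let $h(n)=\tilde O(|P_n|)$, meaning $h(n)=O(|P_n|\log^k n)$ for some constant $k$, and let $\beta(n)$ be subpolynomial, meaning $\beta(n)\le n^{\delta}$ for every constant $\delta>0$ and all $n$ large enough depending on $\delta$. Then for all sufficiently large $n$ there is no set $H$ of at most $h(n)$ directed edges with non-negative weights on the vertex set of $G_n$ such that 1. $\mathrm{dist}_{G_n\cup H}(u,v)=\mathrm{dist}_{G_n}(u,v)$ for all vertices $u,v$ (with $\mathrm{dist}=\infty$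 for unreachable pairs), and 2. for all vertices $x,y$ of $P_n$ such that $x$ reaches $y$ in $G_n$, the graph $G_n\cup H$ contains a path from $x$ to $y$ with at most $\beta(n)$ hops and of length at most $(1+\varepsilon(n))\,\mathrm{dist}_{G_n}(x,y)$. -/

import Mathlib

open Filter Asymptotics
open scoped NNReal ENNReal

/-- A directed graph with non-negative real edge weights. The value `weight u v` is only
meaningful when `u v` is an edge; all definitions below ignore it otherwise. -/
structure WDigraph (V : Type*) extends Digraph V where
  weight : V → V → ℝ≥0

namespace WDigraph

/-- `G.Walk x y k w`: there is a directed walk from `x` to `y` in `G` with exactly `k` edges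
(hops) and total weight `w`. -/
inductive Walk {V : Type*} (G : WDigraph V) : V → V → ℕ → ℝ≥0 → Prop
  | nil (x : V) : Walk G x x 0 0
  | cons {x y z : V} {k : ℕ} {w : ℝ≥0} (h : G.Adj x y) (p : Walk G y z k w) :
      Walk G x z (k + 1) (G.weight x y + w)

/-- `x` reaches `y` in `G`. -/
def Reaches {V : Type*} (G : WDigraph V) (x y : V) : Prop :=
  ∃ (k : ℕ) (w : ℝ≥0), G.Walk x y k w

/-- The weighted distance from `x` to `y`; it is `⊤` if `x` does not reach `y`. -/
noncomputable def dist {V : Type*} (G : WDigraph V) (x y : V) : ℝ≥0∞ :=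
  ⨅ (k : ℕ) (w : ℝ≥0) (_ : G.Walk x y k w), (w : ℝ≥0∞)

/-- A list of vertices is a directed path of `G` with `ℓ` hops: it lists `ℓ + 1` distinct
vertices, consecutive ones being joined by an edge. -/
def IsPath {V : Type*} (G : WDigraph V) (P : List V) (ℓ : ℕ) : Prop :=
  P.length = ℓ + 1 ∧ P.Nodup ∧ P.IsChain G.Adj

/-- All edge weights are positive. -/
def PosWeights {V : Type*} (G : WDigraph V) : Prop :=
  ∀ u v, G.Adj u v → 0 < G.weight u v

/-- The number of edges. -/
noncomputable def edgeCount {V : Type*} (G : WDigraph V) : ℕ :=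
  {e : V × V | G.Adj e.1 e.2}.ncard

open Classical in
/-- The graph `G ∪ H`: the edges of `G` together with those of `H`. For two parallel edges
the lighter one is kept. -/
noncomputable def union {V : Type*} (G H : WDigraph V) : WDigraph V where
  Adj u v := G.Adj u v ∨ H.Adj u v
  weight u v :=
    if G.Adj u v then
      if H.Adj u v then min (G.weight u v) (H.weight u v) else G.weight u v
    else H.weight u v

/-- The weighted edge set `H` is a `(β, ε)`-hopset of `G` for the pairs of vertices of `P`:
adding `H` does not change any distance (in particular, no reachability) in `G`, and whenever
`x` reaches `y` in `G`, with `x, y` on `P`, the graph `G ∪ H` has a walk from `x` to `y` with at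
most `β` hops and of length at most `(1 + ε) dist_G(x, y)`. -/
def IsPathHopset {V : Type*} (G H : WDigraph V) (P : List V) (β : ℕ) (ε : ℝ) : Prop :=
  (∀ u v, (G.union H).dist u v = G.dist u v) ∧
    ∀ x ∈ P, ∀ y ∈ P, G.Reaches x y →
      ∃ (k : ℕ) (w : ℝ≥0), (G.union H).Walk x y k w ∧ k ≤ β ∧
        (w : ℝ≥0∞) ≤ ENNReal.ofReal (1 + ε) * G.dist x y

end WDigraph

/-- `f = n ^ Θ(1)`: `f(n)` lies between two positive powers of `n` for all large `n`. -/
def IsPolynomial (f : ℕ → ℕ) : Prop :=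
  ∃ a b : ℝ, 0 < a ∧ 0 < b ∧
    ∀ᶠ n : ℕ in atTop, (n : ℝ) ^ a ≤ (f n : ℝ) ∧ (f n : ℝ) ≤ (n : ℝ) ^ b

/-- `f = n ^ o(1)`: `f(n)` is eventually below every fixed positive power of `n`. -/
def IsSubpolynomial (f : ℕ → ℕ) : Prop :=
  ∀ δ : ℝ, 0 < δ → ∀ᶠ n : ℕ in atTop, (f n : ℝ) ≤ (n : ℝ) ^ δ

/-- `f = Õ(g)`: `f(n) = O(g(n) · (log n) ^ k)` for some fixed `k`. -/
def IsSoftO (f g : ℕ → ℕ) : Prop :=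
  ∃ k : ℕ, (fun n : ℕ => (f n : ℝ)) =O[atTop] fun n : ℕ => (g n : ℝ) * Real.log n ^ k

/-! Take a unit-weight grid with at most `8 * L ^ 9` points, and string its points along a path of
edges of weight `2 * L + 1`. Each of the `L ^ 10` straight lines (`L ^ 3 * L ^ 5` starting points,
`L ^ 2` slopes) has length `L`, so a `(1 + ε)`-approximate walk between its ends has length at most
`2 * L` and avoids heavy edges. By strict convexity of `a ↦ a ^ 2`, a light walk between these ends
stays on the line (`Aligned.of_below`). Edges of `H` cannot escape this, since they preserve
distances. With fewer than `L` hops, the walk uses an upward edge of `H` on the line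
(`exists_aligned_edge`), and such an edge determines its line. Hence `H` has at least `L ^ 10` edges
(`pow_ten_le_edgeCount`). For `L` of order `ℓ ^ (1 / 9)`, this exceeds `|P|` by a polynomial factor,
which beats any power of `log n`. -/

/-! ### A layered grid

The natural numbers below `(L + 1) * (2 * L ^ 3) * (2 * L ^ 5)` are read as points of a grid, with
coordinates `layer`, `abscissa` and `ordinate`. An edge of slope `a` goes up one layer and
moves the other two coordinates by `a` and `a ^ 2`. -/

namespace LayeredGrid

/-- The point with the given coordinates. -/
def encode (L i x y : ℕ) : ℕ := (i * (2 * L ^ 3) + x) * (2 * L ^ 5) + y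

def layer (L v : ℕ) : ℕ := v / (2 * L ^ 5) / (2 * L ^ 3)

def abscissa (L v : ℕ) : ℕ := v / (2 * L ^ 5) % (2 * L ^ 3)

def ordinate (L v : ℕ) : ℕ := v % (2 * L ^ 5)

/-- The edges of the layered grid. -/
def Step (L u v : ℕ) : Prop :=
  layer L v = layer L u + 1 ∧
    ∃ a, abscissa L v = abscissa L u + a ∧ ordinate L v = ordinate L u + a ^ 2

theorem ordinate_encode {L i x y : ℕ} (hy : y < 2 * L ^ 5) :
    ordinate L (encode L i x y) = y := by
  rw [ordinate, encode, Nat.mul_add_mod', Nat.mod_eq_of_lt hy]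

theorem encode_div {L i x y : ℕ} (hy : y < 2 * L ^ 5) :
    encode L i x y / (2 * L ^ 5) = i * (2 * L ^ 3) + x := by
  rw [encode, mul_comm, Nat.mul_add_div (by omega), Nat.div_eq_of_lt hy, add_zero]

theorem abscissa_encode {L i x y : ℕ} (hx : x < 2 * L ^ 3) (hy : y < 2 * L ^ 5) :
    abscissa L (encode L i x y) = x := by
  rw [abscissa, encode_div hy, Nat.mul_add_mod', Nat.mod_eq_of_lt hx]

theorem layer_encode {L i x y : ℕ} (hx : x < 2 * L ^ 3) (hy : y < 2 * L ^ 5) :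
    layer L (encode L i x y) = i := by
  rw [layer, encode_div hy, mul_comm, Nat.mul_add_div (by omega), Nat.div_eq_of_lt hx, add_zero]

theorem encode_lt {L i x y : ℕ} (hi : i ≤ L) (hx : x < 2 * L ^ 3) (hy : y < 2 * L ^ 5) :
    encode L i x y < 8 * L ^ 9 := by
  have hL : 1 ≤ L := by
    rcases Nat.eq_zero_or_pos L with rfl | h
    · simp at hx
    · exact h
  have h1 : i * (2 * L ^ 3) + x + 1 ≤ (L + 1) * (2 * L ^ 3) := by nlinarith
  have h2 : encode L i x y < (i * (2 * L ^ 3) + x + 1) * (2 * L ^ 5) := by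
    rw [encode]; linarith
  calc encode L i x y < (i * (2 * L ^ 3) + x + 1) * (2 * L ^ 5) := h2
    _ ≤ ((L + L) * (2 * L ^ 3)) * (2 * L ^ 5) := by
        refine Nat.mul_le_mul_right _ (h1.trans ?_)
        gcongr
    _ = 8 * L ^ 9 := by ring

/-! ### Convexity and rigidity of straight lines -/

/-- A relation that contains reachability in the layered grid and forces the straight paths to be
the only paths between their ends. -/
def Below (L u v : ℕ) : Prop :=
  ∀ b : ℤ,
    |((abscissa L v : ℤ) - abscissa L u) - b * ((layer L v : ℤ) - layer L u)| ≤
      ((ordinate L v : ℤ) - ordinate L u) - 2 * b * ((abscissa L v : ℤ) - abscissa L u) +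
        b ^ 2 * ((layer L v : ℤ) - layer L u)

theorem Below.refl (L u : ℕ) : Below L u u := fun b => by simp

theorem Below.trans {L u v w : ℕ} (h₁ : Below L u v) (h₂ : Below L v w) : Below L u w := fun b => by
  have h := (abs_add_le _ _).trans (add_le_add (h₁ b) (h₂ b))
  ring_nf at h ⊢
  exact h

/-- For a step of slope `a` the two sides are `|a - b|` and `(a - b) ^ 2`, and `a - b` is an
integer. -/
theorem Step.below {L u v : ℕ} (h : Step L u v) : Below L u v := fun b => by
  obtain ⟨hl, a, hx, hy⟩ := h
  rw [hl, hx, hy]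
  have h1 : |(a : ℤ) - b| ≤ |(a : ℤ) - b| ^ 2 := by
    rcases (abs_nonneg ((a : ℤ) - b)).eq_or_lt with h0 | h0
    · rw [← h0]; simp
    · exact le_self_pow₀ (by omega) two_ne_zero
  rw [sq_abs] at h1
  push_cast
  ring_nf at h1 ⊢
  exact h1

/-- The displacement from `u` to `v` is a multiple of the step of slope `a`. -/
def Aligned (L a u v : ℕ) : Prop :=
  (abscissa L v : ℤ) - abscissa L u = a * ((layer L v : ℤ) - layer L u) ∧
    (ordinate L v : ℤ) - ordinate L u = a ^ 2 * ((layer L v : ℤ) - layer L u)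

/-- At `b = a` the right-hand sides in `Below` are nonnegative and add up to zero along `s, u, v,
t`, so each vanishes. The absolute values then vanish too, which fixes the abscissa and, in turn,
the ordinate. -/
theorem Aligned.of_below {L a s u v t : ℕ} (hst : Aligned L a s t) (hsu : Below L s u)
    (huv : Below L u v) (hvt : Below L v t) : Aligned L a s u ∧ Aligned L a u v := by
  obtain ⟨h1, h2⟩ := hst
  have e1 := hsu a
  have e2 := huv a
  have e3 := hvt a
  have n1 := abs_nonneg
    (((abscissa L u : ℤ) - abscissa L s) - a * ((layer L u : ℤ) - layer L s))
  have n2 := abs_nonneg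
    (((abscissa L v : ℤ) - abscissa L u) - a * ((layer L v : ℤ) - layer L u))
  have n3 := abs_nonneg
    (((abscissa L t : ℤ) - abscissa L v) - a * ((layer L t : ℤ) - layer L v))
  have z1 : |((abscissa L u : ℤ) - abscissa L s) - a * ((layer L u : ℤ) - layer L s)| = 0 := by
    nlinarith
  have z2 : |((abscissa L v : ℤ) - abscissa L u) - a * ((layer L v : ℤ) - layer L u)| = 0 := by
    nlinarith
  have f1 : ((ordinate L u : ℤ) - ordinate L s) - 2 * a * ((abscissa L u : ℤ) - abscissa L s) +
        a ^ 2 * ((layer L u : ℤ) - layer L s) = 0 := by nlinarith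
  have f2 : ((ordinate L v : ℤ) - ordinate L u) - 2 * a * ((abscissa L v : ℤ) - abscissa L u) +
        a ^ 2 * ((layer L v : ℤ) - layer L u) = 0 := by nlinarith
  rw [abs_eq_zero, sub_eq_zero] at z1 z2
  refine ⟨⟨z1, ?_⟩, z2, ?_⟩
  · rw [z1] at f1; linarith
  · rw [z2] at f2; linarith

/-- The `i`-th point of the straight path of slope `a` that starts at `(0, x, y)`. -/
def linePoint (L x y a i : ℕ) : ℕ := encode L i (x + i * a) (y + i * a ^ 2)

section linePoint

variable {L x y a i : ℕ}

theorem line_abscissa_lt (hx : x < L ^ 3) (ha : a < L ^ 2) (hi : i ≤ L) :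
    x + i * a < 2 * L ^ 3 := by
  have : i * a ≤ L * L ^ 2 := Nat.mul_le_mul hi ha.le
  have e : L * L ^ 2 = L ^ 3 := by ring
  omega

theorem line_ordinate_lt (hy : y < L ^ 5) (ha : a < L ^ 2) (hi : i ≤ L) :
    y + i * a ^ 2 < 2 * L ^ 5 := by
  have : i * a ^ 2 ≤ L * (L ^ 2) ^ 2 := Nat.mul_le_mul hi (Nat.pow_le_pow_left ha.le 2)
  have e : L * (L ^ 2) ^ 2 = L ^ 5 := by ring
  omega

theorem layer_linePoint (hx : x < L ^ 3) (hy : y < L ^ 5) (ha : a < L ^ 2) (hi : i ≤ L) :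
    layer L (linePoint L x y a i) = i :=
  layer_encode (line_abscissa_lt hx ha hi) (line_ordinate_lt hy ha hi)

theorem abscissa_linePoint (hx : x < L ^ 3) (hy : y < L ^ 5) (ha : a < L ^ 2) (hi : i ≤ L) :
    abscissa L (linePoint L x y a i) = x + i * a :=
  abscissa_encode (line_abscissa_lt hx ha hi) (line_ordinate_lt hy ha hi)

theorem ordinate_linePoint (hy : y < L ^ 5) (ha : a < L ^ 2) (hi : i ≤ L) :
    ordinate L (linePoint L x y a i) = y + i * a ^ 2 :=
  ordinate_encode (line_ordinate_lt hy ha hi)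

theorem linePoint_lt (hx : x < L ^ 3) (hy : y < L ^ 5) (ha : a < L ^ 2) (hi : i ≤ L) :
    linePoint L x y a i < 8 * L ^ 9 :=
  encode_lt hi (line_abscissa_lt hx ha hi) (line_ordinate_lt hy ha hi)

end linePoint

theorem step_linePoint {L x y a i : ℕ} (hx : x < L ^ 3) (hy : y < L ^ 5) (ha : a < L ^ 2)
    (hi : i + 1 ≤ L) : Step L (linePoint L x y a i) (linePoint L x y a (i + 1)) := by
  have hi' : i ≤ L := by omega
  refine ⟨?_, a, ?_, ?_⟩
  · rw [layer_linePoint hx hy ha hi, layer_linePoint hx hy ha hi']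
  · rw [abscissa_linePoint hx hy ha hi, abscissa_linePoint hx hy ha hi']; ring
  · rw [ordinate_linePoint hy ha hi, ordinate_linePoint hy ha hi']; ring

theorem aligned_linePoint {L x y a : ℕ} (hx : x < L ^ 3) (hy : y < L ^ 5) (ha : a < L ^ 2) :
    Aligned L a (linePoint L x y a 0) (linePoint L x y a L) := by
  have h0 := Nat.zero_le L
  rw [Aligned, layer_linePoint hx hy ha h0, layer_linePoint hx hy ha le_rfl,
    abscissa_linePoint hx hy ha h0, abscissa_linePoint hx hy ha le_rfl,
    ordinate_linePoint hy ha h0, ordinate_linePoint hy ha le_rfl]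
  push_cast
  constructor <;> ring

/-! ### The weighted graph and its light walks -/

open Classical in
/-- The layered grid with unit weights, together with a Hamiltonian path of heavy edges. -/
noncomputable def graph (n L : ℕ) : WDigraph (Fin n) where
  Adj u v := Step L u v ∨ (v : ℕ) = u + 1
  weight u v := if Step L u v then 1 else 2 * L + 1

theorem graph_posWeights (n L : ℕ) : (graph n L).PosWeights := by
  intro u v _
  simp only [graph]
  split_ifs <;> positivity

theorem graph_isPath {n ℓ : ℕ} (L : ℕ) (h : ℓ < n) :
    (graph n L).IsPath ((List.finRange n).take (ℓ + 1)) ℓ := by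
  refine ⟨by simp; omega, (List.nodup_finRange n).sublist (List.take_sublist _ _), ?_⟩
  rw [List.isChain_iff_getElem]
  intro i hi
  right
  simp

theorem below_of_walk {n L : ℕ} {u v : Fin n} {k : ℕ} {w : ℝ≥0} (p : (graph n L).Walk u v k w)
    (hw : w < 2 * L + 1) : Below L u v := by
  induction p with
  | nil x => exact Below.refl _ _
  | @cons x y z k w h p ih =>
    have hs : Step L x y := by
      by_contra hs
      have : (graph n L).weight x y = 2 * L + 1 := by simp [graph, hs]
      rw [this] at hw
      exact absurd (le_self_add.trans_lt hw) (lt_irrefl _)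
    exact hs.below.trans (ih (le_add_self.trans_lt hw))

theorem below_of_dist_lt {n L : ℕ} {u v : Fin n}
    (h : (graph n L).dist u v < ((2 * L + 1 : ℝ≥0) : ℝ≥0∞)) : Below L u v := by
  simp only [WDigraph.dist, iInf_lt_iff] at h
  obtain ⟨k, w, p, hw⟩ := h
  exact below_of_walk p (by exact_mod_cast hw)

end LayeredGrid

namespace WDigraph

theorem Walk.dist_le {V : Type*} {G : WDigraph V} {x y : V} {k : ℕ} {w : ℝ≥0}
    (p : G.Walk x y k w) : G.dist x y ≤ w :=
  iInf_le_of_le k (iInf_le_of_le w (iInf_le _ p))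

theorem Adj.dist_le {V : Type*} {G : WDigraph V} {x y : V} (h : G.Adj x y) :
    G.dist x y ≤ G.weight x y := by
  simpa using (Walk.cons h (Walk.nil y)).dist_le

end WDigraph

/-! ### Counting the edges of a hopset -/

namespace LayeredGrid

/-- A light walk with fewer hops than layers to climb uses an edge of `H`. -/
theorem exists_edge_of_walk {n L : ℕ} {H : WDigraph (Fin n)}
    (hH : ∀ u v, ((graph n L).union H).dist u v = (graph n L).dist u v)
    {s t : Fin n} {k : ℕ} {w : ℝ≥0} (p : ((graph n L).union H).Walk s t k w)
    (hw : w < 2 * L + 1) :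
    Below L s t ∧ (layer L s + k < layer L t →
      ∃ u v : Fin n, H.Adj u v ∧ layer L u < layer L v ∧
        Below L s u ∧ Below L u v ∧ Below L v t) := by
  induction p with
  | nil x => exact ⟨Below.refl _ _, fun h => absurd h (by omega)⟩
  | @cons x y z k w h p ih =>
    have hxy : Below L x y := by
      -- An edge of `H` too is light, and since `H` preserves distances, a light walk of the grid
      -- joins its ends.
      apply below_of_dist_lt
      rw [← hH]
      refine (WDigraph.Adj.dist_le h).trans_lt ?_
      exact_mod_cast le_self_add.trans_lt hw
    obtain ⟨hyz, ih⟩ := ih (le_add_self.trans_lt hw)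
    refine ⟨hxy.trans hyz, fun hk => ?_⟩
    by_cases hup : layer L x < layer L y ∧ H.Adj x y
    · exact ⟨x, y, hup.2, hup.1, Below.refl _ _, hxy, hyz⟩
    -- Without an upward edge of `H`, a hop gains at most one layer, so the deficit in hops
    -- persists.
    · have hl : layer L y ≤ layer L x + 1 := by
        by_cases hlt : layer L x < layer L y
        · have hn : ¬ H.Adj x y := fun h' => hup ⟨hlt, h'⟩
          have hG : (graph n L).Adj x y := h.resolve_right hn
          by_cases hs : Step L x y
          · exact hs.1.le
          · have e : ((graph n L).union H).weight x y = 2 * L + 1 := by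
              simp only [WDigraph.union, hG, hn, if_true, if_false]
              simp [graph, hs]
            rw [e] at hw
            exact absurd (le_self_add.trans_lt hw) (lt_irrefl _)
        · omega
      obtain ⟨u, v, huv, hlt, h1, h2, h3⟩ := ih (by omega)
      exact ⟨u, v, huv, hlt, hxy.trans h1, h2, h3⟩

theorem walk_linePoint {n L x y a : ℕ} (hx : x < L ^ 3) (hy : y < L ^ 5) (ha : a < L ^ 2)
    (hn : 8 * L ^ 9 ≤ n) (j i : ℕ) (hij : i + j ≤ L) :
    (graph n L).Walk ⟨linePoint L x y a i, (linePoint_lt hx hy ha (by omega)).trans_le hn⟩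
      ⟨linePoint L x y a (i + j), (linePoint_lt hx hy ha hij).trans_le hn⟩ j j := by
  induction j generalizing i with
  | zero => simpa using WDigraph.Walk.nil _
  | succ j ih =>
    have hs := step_linePoint hx hy ha (show i + 1 ≤ L by omega)
    have q := WDigraph.Walk.cons (G := graph n L)
      (x := ⟨linePoint L x y a i, (linePoint_lt hx hy ha (by omega)).trans_le hn⟩)
      (Or.inl hs) (ih (i + 1) (by omega))
    have e : i + 1 + j = i + (j + 1) := by ring
    have e' : (1 : ℝ≥0) + j = ((j + 1 : ℕ) : ℝ≥0) := by push_cast; ring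
    simp only [graph, hs, if_true, e, e'] at q
    exact q

theorem exists_aligned_edge {n L : ℕ} {H : WDigraph (Fin n)} {P : List (Fin n)} {β : ℕ} {ε : ℝ}
    (hn : 8 * L ^ 9 ≤ n) (hP : ∀ v : Fin n, (v : ℕ) < 8 * L ^ 9 → v ∈ P) (hβ : β < L) (hε : ε ≤ 1)
    (hH : (graph n L).IsPathHopset H P β ε) {x y a : ℕ} (hx : x < L ^ 3) (hy : y < L ^ 5)
    (ha : a < L ^ 2) :
    ∃ e : Fin n × Fin n, H.Adj e.1 e.2 ∧ layer L e.1 < layer L e.2 ∧ Aligned L a e.1 e.2 ∧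
      abscissa L e.1 = x + layer L e.1 * a ∧ ordinate L e.1 = y + layer L e.1 * a ^ 2 := by
  obtain ⟨hdist, hhop⟩ := hH
  have hs := linePoint_lt hx hy ha (Nat.zero_le L)
  have ht := linePoint_lt hx hy ha (le_refl L)
  have q := walk_linePoint hx hy ha hn L 0 (by omega)
  simp only [zero_add] at q
  obtain ⟨k, w, p, hk, hw⟩ := hhop _ (hP _ hs) _ (hP _ ht) ⟨_, _, q⟩
  have hw' : w ≤ 2 * L := by
    have h2 : ENNReal.ofReal (1 + ε) ≤ ((2 : ℝ≥0) : ℝ≥0∞) := by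
      rw [ENNReal.ofReal_le_iff_le_toReal (by simp)]
      simp; linarith
    have := hw.trans (mul_le_mul' h2 q.dist_le)
    exact_mod_cast this
  have hlt : w < 2 * L + 1 := hw'.trans_lt (lt_add_one _)
  obtain ⟨u, v, huv, hl, h1, h2, h3⟩ := (exists_edge_of_walk hdist p hlt).2 (by
    simp only [layer_linePoint hx hy ha (Nat.zero_le L), layer_linePoint hx hy ha (le_refl L)]
    omega)
  obtain ⟨⟨b1, b2⟩, b⟩ := (aligned_linePoint hx hy ha).of_below h1 h2 h3
  refine ⟨(u, v), huv, hl, b, ?_, ?_⟩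
  · rw [abscissa_linePoint hx hy ha (Nat.zero_le L), layer_linePoint hx hy ha (Nat.zero_le L)] at b1
    zify
    push_cast at b1
    linarith
  · rw [ordinate_linePoint hy ha (Nat.zero_le L), layer_linePoint hx hy ha (Nat.zero_le L)] at b2
    zify
    push_cast at b2
    linarith

theorem pow_ten_le_edgeCount {n L : ℕ} {H : WDigraph (Fin n)} {P : List (Fin n)} {β : ℕ} {ε : ℝ}
    (hn : 8 * L ^ 9 ≤ n) (hP : ∀ v : Fin n, (v : ℕ) < 8 * L ^ 9 → v ∈ P) (hβ : β < L) (hε : ε ≤ 1)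
    (hH : (graph n L).IsPathHopset H P β ε) : L ^ 10 ≤ H.edgeCount := by
  have key (z : Fin (L ^ 3) × Fin (L ^ 5) × Fin (L ^ 2)) :=
    exists_aligned_edge hn hP hβ hε hH z.1.2 z.2.1.2 z.2.2.2
  choose f hadj hl hal hx hy using key
  have hinj : Function.Injective
      (fun z => (⟨f z, hadj z⟩ : {e : Fin n × Fin n | H.Adj e.1 e.2})) := by
    intro z z' h
    have hf : f z = f z' := congrArg Subtype.val h
    have h1 := (hal z).1
    have h2 := (hal z').1
    rw [hf] at h1
    -- A strictly upward edge reveals its slope; its tail then gives the starting point of the line.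
    have hpos : (0 : ℤ) < layer L (f z').2 - layer L (f z').1 := by
      have := hl z'
      omega
    have ha : (z.2.2 : ℕ) = z'.2.2 := by
      exact_mod_cast mul_right_cancel₀ hpos.ne' (h1.symm.trans h2)
    have hx1 := hx z
    have hy1 := hy z
    rw [hf, ha] at hx1 hy1
    have hx2 := hx1.symm.trans (hx z')
    have hy2 := hy1.symm.trans (hy z')
    refine Prod.ext (Fin.ext ?_) (Prod.ext (Fin.ext ?_) (Fin.ext ha)) <;> omega
  have hcard := Nat.card_le_card_of_injective _ hinj
  rw [WDigraph.edgeCount, ← Nat.card_coe_set_eq]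
  refine le_trans (le_of_eq ?_) hcard
  simp only [Nat.card_prod, Nat.card_fin]
  ring

/-! ### Choice of the height and asymptotics -/

/-- The largest height of a layered grid on at most `m` points. -/
def height (m : ℕ) : ℕ := Nat.findGreatest (fun L => 8 * L ^ 9 ≤ m) m

theorem height_spec (m : ℕ) : 8 * height m ^ 9 ≤ m :=
  Nat.findGreatest_spec (P := fun L => 8 * L ^ 9 ≤ m) (Nat.zero_le m) (by simp)

theorem lt_height_succ (m : ℕ) : m < 8 * (height m + 1) ^ 9 := by
  by_contra! h
  have h1 : height m + 1 ≤ m := by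
    have := Nat.le_self_pow (n := 9) (by norm_num) (height m + 1)
    omega
  have := Nat.le_findGreatest (P := fun L => 8 * L ^ 9 ≤ m) h1 h
  rw [← height] at this
  omega

theorem rpow_lt_height_succ {n m : ℕ} {a : ℝ} (ha : (n : ℝ) ^ a ≤ m)
    (h8 : 8 * ((n : ℝ) ^ (a / 10)) ^ 9 ≤ (n : ℝ) ^ a) : (n : ℝ) ^ (a / 10) < height m + 1 := by
  by_contra! h
  have h1 : (m : ℝ) < 8 * (height m + 1) ^ 9 := by exact_mod_cast lt_height_succ m
  have h2 : ((height m : ℝ) + 1) ^ 9 ≤ ((n : ℝ) ^ (a / 10)) ^ 9 := by gcongr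
  linarith

theorem lt_pow_ten {h C m p L : ℝ} (hh : h ≤ C * (m * p)) (hm0 : 0 ≤ m)
    (hm : m ≤ 8 * (L + 1) ^ 9) (hL : 1 ≤ L) (hp : 0 ≤ p) (hpL : |C| * 4096 * p < L) : h < L ^ 10 := by
  have h1 : (L + 1) ^ 9 ≤ (2 * L) ^ 9 := pow_le_pow_left₀ (by linarith) (by linarith) 9
  have h2 : m * p ≤ 8 * (2 * L) ^ 9 * p := mul_le_mul_of_nonneg_right (by linarith) hp
  calc h ≤ C * (m * p) := hh
    _ ≤ |C| * (m * p) := mul_le_mul_of_nonneg_right (le_abs_self C) (mul_nonneg hm0 hp)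
    _ ≤ |C| * (8 * (2 * L) ^ 9 * p) := mul_le_mul_of_nonneg_left h2 (abs_nonneg C)
    _ = (|C| * 4096 * p) * L ^ 9 := by ring
    _ < L * L ^ 9 := mul_lt_mul_of_pos_right hpL (by positivity)
    _ = L ^ 10 := by ring

theorem eventually_lt_height {ℓ h β : ℕ → ℕ} {a C : ℝ} {k : ℕ} (ha : 0 < a)
    (hℓ : ∀ᶠ n : ℕ in atTop, (n : ℝ) ^ a ≤ ℓ n)
    (hh : ∀ᶠ n : ℕ in atTop, (h n : ℝ) ≤ C * ((ℓ n + 1 : ℕ) * Real.log n ^ k))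
    (hβ : IsSubpolynomial β) :
    ∀ᶠ n : ℕ in atTop, β n < height (ℓ n + 1) ∧ h n < height (ℓ n + 1) ^ 10 := by
  have hc : 0 < a / 10 := by positivity
  have hcast := tendsto_natCast_atTop_atTop (R := ℝ)
  have hpow := (tendsto_rpow_atTop hc).comp hcast
  have hlog : ∀ᶠ n : ℕ in atTop, |C| * 4096 * Real.log n ^ k ≤ 1 / 2 * (n : ℝ) ^ (a / 10) := by
    have h1 := ((isLittleO_log_rpow_rpow_atTop k hc).const_mul_left (|C| * 4096)).comp_tendsto hcast
    filter_upwards [h1.bound (show (0 : ℝ) < 1 / 2 by norm_num)] with n hn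
    simp only [Function.comp_apply, Real.rpow_natCast, Real.norm_eq_abs] at hn
    rw [abs_of_nonneg (a := (n : ℝ) ^ (a / 10)) (by positivity)] at hn
    exact (le_abs_self _).trans hn
  -- With `t = n ^ (a / 10)`, the bound `t ≥ 8` absorbs the factor `8` in `8 * t ^ 9 ≤ t ^ 10`,
  -- giving `t < L + 1` and `L > 7`. The exponent `a / 20` makes `β n ^ 2 ≤ t`, hence `β n < L`.
  filter_upwards [hℓ, hh, hβ (a / 20) (by positivity), hlog, hpow.eventually_ge_atTop 8,
    eventually_ge_atTop 1] with n h1 h2 h3 h4 h5 h6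
  simp only [Function.comp_apply] at h5
  have hn0 : (0 : ℝ) ≤ n := by positivity
  set t := (n : ℝ) ^ (a / 10) with ht
  have e10 : (n : ℝ) ^ a = t ^ 9 * t := by
    rw [← pow_succ, ht, ← Real.rpow_natCast, ← Real.rpow_mul hn0]
    congr 1; push_cast; ring
  have e2 : ((n : ℝ) ^ (a / 20)) ^ 2 = t := by
    rw [ht, ← Real.rpow_natCast, ← Real.rpow_mul hn0]
    congr 1; push_cast; ring
  have hL := rpow_lt_height_succ (m := ℓ n + 1) (a := a) (by push_cast; linarith)
    (by rw [e10, ← ht, mul_comm]; gcongr)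
  rw [← ht] at hL
  set L := height (ℓ n + 1) with hLdef
  have hm : ((ℓ n + 1 : ℕ) : ℝ) < 8 * (L + 1) ^ 9 := by
    exact_mod_cast lt_height_succ (ℓ n + 1)
  have hL7 : (7 : ℝ) < L := by linarith
  constructor
  · have : (β n : ℝ) < L := by nlinarith
    exact_mod_cast this
  · have hlog0 : 0 ≤ Real.log n ^ k := pow_nonneg (Real.log_natCast_nonneg n) k
    have := lt_pow_ten h2 (Nat.cast_nonneg _) hm.le (by linarith) hlog0 (by linarith)
    exact_mod_cast this

end LayeredGrid

open LayeredGrid in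
theorem mainTheorem4 :
    ∃ (G : ∀ n : ℕ, ℝ → ℕ → WDigraph (Fin n)) (P : ∀ n : ℕ, ℝ → ℕ → List (Fin n)),
      (∀ (n : ℕ) (ε : ℝ) (ℓ : ℕ), 0 ≤ ε → ε ≤ 1 → 1 ≤ ℓ → ℓ < n →
        (G n ε ℓ).PosWeights ∧ (G n ε ℓ).IsPath (P n ε ℓ) ℓ) ∧
      ∀ (ε : ℕ → ℝ) (ℓ : ℕ → ℕ),
        (∀ n, 0 ≤ ε n ∧ ε n ≤ 1) → (∀ᶠ n : ℕ in atTop, ℓ n < n) → IsPolynomial ℓ →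
        ∀ h β : ℕ → ℕ,
          IsSoftO h (fun n => (P n (ε n) (ℓ n)).length) → IsSubpolynomial β →
          ∀ᶠ n : ℕ in atTop,
            ¬ ∃ H : WDigraph (Fin n), H.edgeCount ≤ h n ∧
              (G n (ε n) (ℓ n)).IsPathHopset H (P n (ε n) (ℓ n)) (β n) (ε n) := by
  refine ⟨fun n _ ℓ => graph n (height (ℓ + 1)), fun n _ ℓ => (List.finRange n).take (ℓ + 1),
    fun n ε ℓ _ _ _ hℓ => ⟨graph_posWeights _ _, graph_isPath _ hℓ⟩, ?_⟩
  rintro ε ℓ hε hℓ ⟨a, _, ha, -, hab⟩ h β ⟨k, hk⟩ hβ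
  obtain ⟨C, hC⟩ := hk.bound
  have hh : ∀ᶠ n : ℕ in atTop, (h n : ℝ) ≤ C * ((ℓ n + 1 : ℕ) * Real.log n ^ k) := by
    filter_upwards [hC, hℓ] with n hn hlt
    rw [(graph_isPath 0 hlt).1, Real.norm_of_nonneg (by positivity),
      Real.norm_of_nonneg (mul_nonneg (by positivity)
        (pow_nonneg (Real.log_natCast_nonneg n) k))] at hn
    exact hn
  filter_upwards [hℓ, eventually_lt_height ha (hab.mono fun _ h => h.1) hh hβ]
    with n hlt ⟨hβn, hhn⟩
  rintro ⟨H, hcount, hH⟩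
  have hspec := height_spec (ℓ n + 1)
  have := pow_ten_le_edgeCount (by omega) (fun v hv => ?_) hβn (hε n).2 hH
  · omega
  · rw [List.mem_take_iff_getElem]
    exact ⟨v, by simp; omega, by simp⟩
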